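/- **Abel's theorem.** A calculator with unlimited memory operates exactly on complex numbers and has the keys $1,+,-,\times,:$ and, for every integer $k\ge 1$, a key $\sqrt[k]{\ }$ which produces all complex $k$-th roots of a number, listed in an arbitrary (unpredictable) order. Division by $0$ is an error that stops the calculator. A program for the calculator is a rule that, depending on the numbers currently in memory (the input and all results obtained so far), either presses a key, applied to numbers in memory, or stops and outputs a finite set of numbers in memory; so fixed sequences of keys, branching and loops are all allowed. A *radical formula* in $a_0,\dots,a_n$ consists of an integer $s\ge 0$, positive integers $k_1,\dots,k_s$ and rational functions $p_1,\dots,p_s$ with complex coefficients, where $p_j$ is a quotient of two polynomials (the denominator not being the zero polynomial) in the $n+j$ variables $a_0,\dots,a_n,z_1,\dots,z_{j-1}$. Given $a_0,\dots,a_n\in\mathbb C$, the values of the expression $z_j$ are the numbers $z_j$ occurring in systems $(z_1,\dots,z_j)\in\mathbb C^j$ such that for each $i\le j$ the denominator of $p_i$ does not vanish at $(a_0,\dots,a_n,z_1,\dots,z_{i-1})$ and $$z_i^{k_i}=p_i(a_0,\dots,a_n,z_1,\dots,z_{i-1}).$$ The formula *solves* the equation $a_nz^n+\dots+a_1z+a_0=0$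 at $(a_0,\dots,a_n)$ if every complex root of this equation is one of the values of one of the expressions $z_1,\dots,z_s$. Let $n\ge 5$. Then: 1. There is no program for the calculator which, given the coefficients $a_0,\dots,a_n$ of any complex polynomial of degree exactly $n$, and however the calculator orders the values of roots, stops after finitely many steps without an error and outputs a finite set of numbers containing all roots of the polynomial. 2. The equation $a_nz^n+\dots+a_1z+a_0=0$ with variable complex coefficients is not solvable in radicals: there is no radical formula which solves it at all $(a_0,\dots,a_n)\in\mathbb C^{n+1}$ with $a_n\neq0$. Moreover, for every nonzero polynomial $D\in\mathbb C[a_0,\dots,a_n]$ there is no radical formula which solves it at all $(a_0,\dots,a_n)$ with $a_n\ne0$ and $D(a_0,\dots,a_n)\neq 0$. -/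

import Mathlib

/-- The keys of the calculator. Arguments are addresses of numbers in the memory; `root k i` is the
key for the `k`-th root, applied to the number at address `i`. -/
inductive CalcKey where
  | one : CalcKey
  | add (i j : ℕ) : CalcKey
  | sub (i j : ℕ) : CalcKey
  | mul (i j : ℕ) : CalcKey
  | div (i j : ℕ) : CalcKey
  | root (k i : ℕ) : CalcKey

/-- `CalcKey.Press m b m'`: if the memory of the calculator is `m`, then pressing the key `b` can
turn it into `m'`. The memory is unbounded and nothing in it is ever erased: every key appends
its results. The `k`-th root (`k ≥ 1`) appends all `k`-th roots of a number, in an arbitrary order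
(with multiplicity, so `k` copies of `0` if the number is `0`). Division by `0`, as
well as a reference to an empty memory cell, is an error: then there is no `m'`. -/
inductive CalcKey.Press : List ℂ → CalcKey → List ℂ → Prop
  | one (m : List ℂ) : CalcKey.Press m CalcKey.one (m ++ [1])
  | add (m : List ℂ) (i j : ℕ) (x y : ℂ) (hx : m[i]? = some x) (hy : m[j]? = some y) :
      CalcKey.Press m (CalcKey.add i j) (m ++ [x + y])
  | sub (m : List ℂ) (i j : ℕ) (x y : ℂ) (hx : m[i]? = some x) (hy : m[j]? = some y) :
      CalcKey.Press m (CalcKey.sub i j) (m ++ [x - y])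
  | mul (m : List ℂ) (i j : ℕ) (x y : ℂ) (hx : m[i]? = some x) (hy : m[j]? = some y) :
      CalcKey.Press m (CalcKey.mul i j) (m ++ [x * y])
  | div (m : List ℂ) (i j : ℕ) (x y : ℂ) (hx : m[i]? = some x) (hy : m[j]? = some y)
      (hy0 : y ≠ 0) : CalcKey.Press m (CalcKey.div i j) (m ++ [x / y])
  | root (m : List ℂ) (k i : ℕ) (x : ℂ) (l : List ℂ) (hk : 0 < k) (hx : m[i]? = some x)
      (hl : (l : Multiset ℂ) = Polynomial.nthRoots k x) :
      CalcKey.Press m (CalcKey.root k i) (m ++ l)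

/-- What a program can do next: press a key, or stop and output the numbers that are stored at
finitely many given addresses. -/
inductive CalcAction where
  | press (b : CalcKey) : CalcAction
  | output (S : Finset ℕ) : CalcAction

/-- A program for the calculator, in the widest sense: a rule that determines the next action from
the current content of the memory (which, as nothing is erased, records the whole history of the
computation). This includes fixed sequences of keys, as well as arbitrary branching and loops. The
only way in which a program can produce new numbers is to press keys. -/
def CalcProgram : Type := List ℂ → CalcAction

/-- `P.Yields R m`: however the calculator orders the values of the roots, the program `P` started
with memory `m` stops after finitely many steps, without an error, and the finite set that it
outputs contains `R`. -/
inductive CalcProgram.Yields (P : CalcProgram) (R : Set ℂ) : List ℂ → Prop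
  | output (m : List ℂ) (S : Finset ℕ) (hP : P m = CalcAction.output S)
      (hR : ∀ w ∈ R, ∃ i ∈ S, m[i]? = some w) : CalcProgram.Yields P R m
  | press (m : List ℂ) (b : CalcKey) (hP : P m = CalcAction.press b)
      (hne : ∃ m' : List ℂ, CalcKey.Press m b m')
      (hall : ∀ m' : List ℂ, CalcKey.Press m b m' → CalcProgram.Yields P R m') :
      CalcProgram.Yields P R m

/-- The set of complex roots of `a_n z ^ n + ⋯ + a_1 z + a_0`. -/
def rootsOfCoeffs {n : ℕ} (a : Fin (n + 1) → ℂ) : Set ℂ :=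
  {w : ℂ | ∑ i : Fin (n + 1), a i * w ^ (i : ℕ) = 0}

/-- From the coefficients `a_0, …, a_n` of any complex polynomial of degree `n`, the program `P`
outputs a finite set of numbers that contains all roots of the polynomial. -/
def CalcProgram.FindsRoots (P : CalcProgram) (n : ℕ) : Prop :=
  ∀ a : Fin (n + 1) → ℂ, a (Fin.last n) ≠ 0 → P.Yields (rootsOfCoeffs a) (List.ofFn a)

/-- A radical formula in `a_0, …, a_n`: rational functions `p_j = num j / den j` in the variables
`a_0, …, a_n, z_1, …, z_{j-1}`, and positive integers `k_j`, for `j = 1, …, s` (indexed here by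
`Fin s`). -/
structure RadicalFormula (n : ℕ) where
  s : ℕ
  num : (j : Fin s) → MvPolynomial (Fin (n + 1) ⊕ Fin (j : ℕ)) ℂ
  den : (j : Fin s) → MvPolynomial (Fin (n + 1) ⊕ Fin (j : ℕ)) ℂ
  den_ne_zero : ∀ j : Fin s, den j ≠ 0
  k : Fin s → ℕ
  k_pos : ∀ j : Fin s, 0 < k j

/-- The values of `a_0, …, a_n, z_1, …, z_{j-1}`, the arguments of `p_j`. -/
def RadicalFormula.args {n : ℕ} (F : RadicalFormula n) (a : Fin (n + 1) → ℂ) (z : Fin F.s → ℂ)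
    (j : Fin F.s) : Fin (n + 1) ⊕ Fin (j : ℕ) → ℂ :=
  Sum.elim a (fun i : Fin (j : ℕ) => z (Fin.castLE j.isLt.le i))

/-- The relation `z_j ^ k_j = p_j(a_0, …, a_n, z_1, …, z_{j-1})`, with `p_j` defined there. -/
def RadicalFormula.Relation {n : ℕ} (F : RadicalFormula n) (a : Fin (n + 1) → ℂ) (z : Fin F.s → ℂ)
    (j : Fin F.s) : Prop :=
  MvPolynomial.eval (F.args a z j) (F.den j) ≠ 0 ∧
    z j ^ F.k j =
      MvPolynomial.eval (F.args a z j) (F.num j) / MvPolynomial.eval (F.args a z j) (F.den j)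

/-- `w` is one of the values of the expression `z_j` at the coefficients `a`. Only the
expressions `z_1, …, z_j` have to be defined. -/
def RadicalFormula.IsValue {n : ℕ} (F : RadicalFormula n) (a : Fin (n + 1) → ℂ) (j : Fin F.s)
    (w : ℂ) : Prop :=
  ∃ z : Fin F.s → ℂ, (∀ i : Fin F.s, i ≤ j → F.Relation a z i) ∧ z j = w

/-- At the coefficients `a`, every root of the equation is one of the values of one of the
expressions `z_1, …, z_s`. -/
def RadicalFormula.SolvesAt {n : ℕ} (F : RadicalFormula n) (a : Fin (n + 1) → ℂ) : Prop :=
  ∀ w ∈ rootsOfCoeffs a, ∃ j : Fin F.s, F.IsValue a j w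

/-- The equation `a_n z ^ n + ⋯ + a_1 z + a_0 = 0` with variable complex coefficients, `a_n ≠ 0`, is
solvable in radicals. -/
def GeneralEquationSolvableInRadicals (n : ℕ) : Prop :=
  ∃ F : RadicalFormula n, ∀ a : Fin (n + 1) → ℂ, a (Fin.last n) ≠ 0 → F.SolvesAt a

/-! Let `K` be a countable subfield of ℂ containing all constants in play, and let `w_1, …, w_n` in
ℂ be algebraically independent over `K`. The symmetric group acts on `K(x_1, …, x_n)`, embedded in ℂ
by `x_i ↦ w_i`; its fixed field contains the coefficients of `∏ (X - w_i)`. The numbers expressible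
by radicals over the fixed field form a subfield `S` closed under extracting roots. If some `w_i`
were in `S`, its minimal polynomial over the fixed field would have a solvable Galois group, into
which the symmetric group embeds: impossible for `n ≥ 5` (`exists_radicalClosed_subfield`).

Neither key presses nor radical formulas over `K` lead out of `S`, so neither reaches a root. The
condition `D ≠ 0` excludes nothing: a polynomial with generic roots avoids the zero set of `D`
(`eval_coeff_prod_ne_zero`). -/

/-- If an element `x` of a field with a finite group action becomes, in some extension, expressible
by radicals over the fixed field, and only `1` fixes the orbit of `x` pointwise, then the group is
solvable. -/
theorem isSolvable_of_mem_solvableByRad_fixedPoints {G L E : Type*} [Group G] [Finite G] [Field L]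
    [MulSemiringAction G L] [Field E] [Algebra L E] (x : L)
    (hx : ∀ g : G, (∀ h : G, g • h • x = h • x) → g = 1)
    (hrad : algebraMap L E x ∈ solvableByRad (FixedPoints.subfield G L) E) :
    Group.IsSolvable G := by
  let F := FixedPoints.subfield G L
  have hmin : minpoly F (algebraMap L E x) = minpoly F x :=
    minpoly.algebraMap_eq (algebraMap L E).injective x
  have hsol : Group.IsSolvable (minpoly F x).Gal := hmin ▸ isSolvable_gal_minpoly hrad
  have : Fact (((minpoly F x).map (algebraMap F L)).Splits) := ⟨IsGalois.splits F x⟩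
  have hint : IsIntegral F x := IsGalois.integral F x
  let φ : G →* (minpoly F x).Gal :=
    (Polynomial.Gal.restrict (minpoly F x) L).comp (MulSemiringAction.toAlgAut G F L)
  refine Group.isSolvable_of_isSolvable_injective (f := φ)
    ((injective_iff_map_eq_one φ).2 fun g hg => hx g fun h => ?_)
  -- The conjugates of `x` are roots of its minimal polynomial, so a `g` in the kernel of `φ` fixes
  -- each of them.
  have hroot : h • x ∈ (minpoly F x).rootSet L := by
    rw [Polynomial.mem_rootSet]
    refine ⟨minpoly.ne_zero hint, ?_⟩
    have := Polynomial.aeval_algHom_apply (MulSemiringAction.toAlgAut G F L h) x (minpoly F x)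
    simpa using this
  have := Polynomial.Gal.restrict_smul (p := minpoly F x) (E := L)
    (MulSemiringAction.toAlgAut G F L g) ⟨h • x, hroot⟩
  have h1 : Polynomial.Gal.restrict (minpoly F x) L (MulSemiringAction.toAlgAut G F L g) = 1 := hg
  rw [h1, one_smul] at this
  exact this.symm

/-- The action of a group on polynomials by permutations of the variables. -/
@[reducible]
noncomputable def MvPolynomial.permMulSemiringAction (σ K : Type*) [CommSemiring K] :
    MulSemiringAction (Equiv.Perm σ) (MvPolynomial σ K) where
  smul g p := MvPolynomial.rename g p
  one_smul p := MvPolynomial.rename_id_apply p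
  mul_smul g h p := (MvPolynomial.rename_rename h g p).symm
  smul_zero _ := map_zero _
  smul_add _ := map_add _
  smul_one _ := map_one _
  smul_mul _ := map_mul _

open Polynomial in
/-- For algebraically independent `w`, no root of `∏ (X - w i)` is expressible by radicals through
the coefficients, once there are at least five roots. -/
theorem exists_radicalClosed_subfield {σ K E : Type*} [Fintype σ] (hσ : 5 ≤ Fintype.card σ)
    [Field K] [Field E] [Algebra K E] {w : σ → E} (hw : AlgebraicIndependent K w) :
    ∃ S : Subfield E, (∀ k : ℕ, k ≠ 0 → ∀ x : E, x ^ k ∈ S → x ∈ S) ∧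
      (∀ c : K, algebraMap K E c ∈ S) ∧ (∀ j : ℕ, (∏ i, (X - C (w i))).coeff j ∈ S) ∧
      ∀ i, w i ∉ S := by
  classical
  let A := MvPolynomial σ K
  let L := FractionRing A
  let G := Equiv.Perm σ
  let : MulSemiringAction G A := MvPolynomial.permMulSemiringAction σ K
  let : MulSemiringAction G L := IsFractionRing.mulSemiringAction G A L
  have : SMulDistribClass G A L := IsFractionRing.smulDistribClass G A L
  have hsmul (g : G) (p : A) : g • algebraMap A L p = algebraMap A L (MvPolynomial.rename g p) :=
    (algebraMap.coe_smul' g p L).symm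
  have hinj : Function.Injective (MvPolynomial.aeval (R := K) w) := hw
  -- The embedding `x_i ↦ w_i` extends to fractions because algebraic independence makes it
  -- injective on polynomials.
  let : Algebra L E := (IsFractionRing.lift (K := L) (g := (MvPolynomial.aeval w : A →ₐ[K] E)
    |>.toRingHom) hinj).toAlgebra
  have hmap (p : A) : algebraMap L E (algebraMap A L p) = MvPolynomial.aeval w p :=
    IsFractionRing.lift_algebraMap (K := L) (g := (MvPolynomial.aeval w : A →ₐ[K] E).toRingHom)
      hinj p
  let F := FixedPoints.subfield G L
  have hfix (p : A) (hp : ∀ g : G, MvPolynomial.rename g p = p) :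
      MvPolynomial.aeval w p ∈ solvableByRad F E := by
    have hF : algebraMap A L p ∈ F := fun g => by rw [hsmul, hp]
    rw [← hmap]
    exact (solvableByRad F E).algebraMap_mem ⟨_, hF⟩
  refine ⟨(solvableByRad F E).toSubfield, fun k hk x hx => solvableByRad.rad_mem hk hx,
    fun c => ?_, fun j => ?_, fun i hi => ?_⟩
  · simpa using hfix (MvPolynomial.C c) (by simp)
  · let Q : A[X] := ∏ i, (X - C (MvPolynomial.X i))
    have hQ : (∏ i, (X - C (w i))) = Q.map (MvPolynomial.aeval (R := K) w).toRingHom := by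
      simp [Q, Polynomial.map_prod]
    rw [hQ, Polynomial.coeff_map]
    refine hfix _ fun g => ?_
    -- Permuting the variables only permutes the factors of `Q`, so its coefficients are symmetric.
    have hg : Q.map (MvPolynomial.rename (R := K) g).toRingHom = Q := by
      simp only [Q, Polynomial.map_prod, Polynomial.map_sub, Polynomial.map_X, Polynomial.map_C]
      simpa using Equiv.prod_comp g fun i => (X - C (MvPolynomial.X i) : A[X])
    exact (Polynomial.coeff_map _ _).symm.trans (congrArg (fun q => q.coeff j) hg)
  · refine Equiv.Perm.not_isSolvable σ (by simpa using hσ)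
      (isSolvable_of_mem_solvableByRad_fixedPoints (E := E)
        (algebraMap A L (MvPolynomial.X i)) (fun g hg => ?_) ?_)
    · ext j
      -- The transposition moves `X i` to `X j`, so a `g` fixing the whole orbit fixes every index
      -- `j`.
      have := hg (Equiv.swap i j)
      simp only [hsmul, MvPolynomial.rename_X] at this
      have hj : g (Equiv.swap i j i) = Equiv.swap i j i :=
        MvPolynomial.X_injective (IsFractionRing.injective A L this)
      rwa [Equiv.swap_apply_left] at hj
    · rw [hmap, MvPolynomial.aeval_X]
      exact hi

/-- Over a countable field, a transcendence basis of the uncountable field ℂ has the cardinality of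
ℂ, so it contains `n` distinct elements. -/
theorem exists_algebraicIndependent_of_countable {K : Type} [Field K] [Countable K] [Algebra K ℂ]
    (n : ℕ) :
    ∃ w : Fin n → ℂ, AlgebraicIndependent K w := by
  obtain ⟨s, hs⟩ := exists_isTranscendenceBasis K ℂ
  have hℂ : Cardinal.aleph0 < Cardinal.mk ℂ := Cardinal.mk_complex ▸ Cardinal.aleph0_lt_continuum
  have hcard := IsAlgClosed.cardinal_eq_cardinal_transcendence_basis_of_aleph0_lt' _ hs
    (Cardinal.mk_le_aleph0_iff.2 ‹_›) hℂ
  have : Infinite s := by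
    rw [Cardinal.infinite_iff, ← hcard]
    exact hℂ.le
  let f : Fin n ↪ s := Fin.valEmbedding.trans (Infinite.natEmbedding s)
  exact ⟨_, hs.1.comp f f.injective⟩

theorem mem_rootsOfCoeffs_prod {n : ℕ} (c : ℂ) (w : Fin n → ℂ) (j : Fin n) :
    w j ∈ rootsOfCoeffs fun i : Fin (n + 1) =>
      c * (∏ l, (Polynomial.X - Polynomial.C (w l))).coeff i := by
  have hdeg : (∏ l, (Polynomial.X - Polynomial.C (w l))).natDegree < n + 1 := by simp
  have h := Polynomial.eval_eq_sum_range' hdeg (w j)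
  rw [Polynomial.eval_prod, Finset.prod_eq_zero (Finset.mem_univ j) (by simp),
    ← Fin.sum_univ_eq_sum_range] at h
  simp only [rootsOfCoeffs, Set.mem_ofPred_eq, mul_assoc, ← Finset.mul_sum, ← h, mul_zero]

/-- This turns a point of coefficient space into a point of root space (roots with multiplicity), at
which identities in generic roots can be specialised. -/
theorem exists_coeffs_eq_prod {n : ℕ} (b : Fin (n + 1) → ℂ) (hb : b (Fin.last n) ≠ 0) :
    ∃ r : Fin n → ℂ, ∀ i : Fin (n + 1),
      b i = b (Fin.last n) * (∏ l, (Polynomial.X - Polynomial.C (r l))).coeff i := by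
  let p : Polynomial ℂ := ∑ i : Fin (n + 1), Polynomial.monomial i (b i)
  have hcoeff (i : Fin (n + 1)) : p.coeff i = b i := by
    simp [p, Polynomial.coeff_monomial, Fin.val_inj]
  have hle : p.natDegree ≤ n := Polynomial.natDegree_sum_le_of_forall_le _ _ fun i _ =>
    (Polynomial.natDegree_monomial_le _).trans (Nat.lt_succ_iff.1 i.isLt)
  have hn : p.coeff n = b (Fin.last n) := hcoeff (Fin.last n)
  have hdeg : p.natDegree = n := le_antisymm hle (Polynomial.le_natDegree_of_ne_zero (hn ▸ hb))
  have hsplit := IsAlgClosed.splits p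
  obtain ⟨l, hl⟩ := Quot.exists_rep p.roots
  have hlen : l.length = n := by
    have := hsplit.natDegree_eq_card_roots
    rw [← hl] at this
    exact this.symm.trans hdeg
  subst hlen
  refine ⟨l.get, fun i => ?_⟩
  have hprod : (p.roots.map (Polynomial.X - Polynomial.C ·)).prod =
      ∏ j, (Polynomial.X - Polynomial.C (l.get j)) := by
    rw [← hl]
    change ((l : Multiset ℂ).map _).prod = _
    rw [Multiset.map_coe, Multiset.prod_coe, ← List.prod_ofFn]
    congr 1
    conv_lhs => rw [← List.ofFn_get l, List.map_ofFn]
    rfl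
  have hp := hsplit.eq_prod_roots
  rw [hprod, Polynomial.leadingCoeff, hdeg, hn] at hp
  rw [← hcoeff i, hp, Polynomial.coeff_C_mul]

theorem CalcKey.Press.forall_mem {S : Subfield ℂ}
    (hS : ∀ k : ℕ, k ≠ 0 → ∀ x : ℂ, x ^ k ∈ S → x ∈ S) {m m' : List ℂ} {b : CalcKey}
    (h : CalcKey.Press m b m') (hm : ∀ x ∈ m, x ∈ S) : ∀ x ∈ m', x ∈ S := by
  have hget {i : ℕ} {x : ℂ} (hx : m[i]? = some x) : x ∈ S := hm x (List.mem_of_getElem? hx)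
  intro y hy
  cases h with
  | root k i x l hk hx hl =>
    rcases List.mem_append.1 hy with hy | hy
    · exact hm y hy
    · have hy' : y ∈ Polynomial.nthRoots k x := hl ▸ Multiset.mem_coe.2 hy
      exact hS k hk.ne' y ((Polynomial.mem_nthRoots hk).1 hy' ▸ hget hx)
  | one =>
    rcases List.mem_append.1 hy with hy | hy
    · exact hm y hy
    · exact List.mem_singleton.1 hy ▸ S.one_mem
  | add i j u v hu hv =>
    rcases List.mem_append.1 hy with hy | hy
    · exact hm y hy
    · exact List.mem_singleton.1 hy ▸ S.add_mem (hget hu) (hget hv)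
  | sub i j u v hu hv =>
    rcases List.mem_append.1 hy with hy | hy
    · exact hm y hy
    · exact List.mem_singleton.1 hy ▸ S.sub_mem (hget hu) (hget hv)
  | mul i j u v hu hv =>
    rcases List.mem_append.1 hy with hy | hy
    · exact hm y hy
    · exact List.mem_singleton.1 hy ▸ S.mul_mem (hget hu) (hget hv)
  | div i j u v hu hv hv0 =>
    rcases List.mem_append.1 hy with hy | hy
    · exact hm y hy
    · exact List.mem_singleton.1 hy ▸ S.div_mem (hget hu) (hget hv)

/-- One possible run is enough, and `hne` supplies it. How the program chooses its keys is
irrelevant, since each key keeps the memory inside `S`. -/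
theorem CalcProgram.Yields.subset {S : Subfield ℂ}
    (hS : ∀ k : ℕ, k ≠ 0 → ∀ x : ℂ, x ^ k ∈ S → x ∈ S) {P : CalcProgram} {R : Set ℂ} {m : List ℂ}
    (h : P.Yields R m) (hm : ∀ x ∈ m, x ∈ S) : R ⊆ S := by
  induction h with
  | output m T hP hR =>
    intro w hw
    obtain ⟨i, -, hi⟩ := hR w hw
    exact hm w (List.mem_of_getElem? hi)
  | press m b hP hne hall ih =>
    obtain ⟨m', hm'⟩ := hne
    exact ih m' hm' (hm'.forall_mem hS hm)

theorem RadicalFormula.IsValue.mem {S : Subfield ℂ}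
    (hS : ∀ k : ℕ, k ≠ 0 → ∀ x : ℂ, x ^ k ∈ S → x ∈ S) {n : ℕ} {F : RadicalFormula n}
    (hnum : ∀ j d, (F.num j).coeff d ∈ S) (hden : ∀ j d, (F.den j).coeff d ∈ S)
    {a : Fin (n + 1) → ℂ} (ha : ∀ i, a i ∈ S) {j : Fin F.s} {w : ℂ} (h : F.IsValue a j w) :
    w ∈ S := by
  obtain ⟨z, hz, rfl⟩ := h
  suffices ∀ i ≤ j, z i ∈ S from this j le_rfl
  intro i
  induction i using WellFoundedLT.induction with
  | ind i ih =>
    intro hij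
    have hargs : ∀ l, F.args a z i l ∈ S := by
      rintro (l | l)
      · exact ha l
      · exact ih _ l.isLt (le_trans (Fin.le_def.2 l.isLt.le) hij)
    refine hS _ (F.k_pos i).ne' _ ((hz i hij).2 ▸ ?_)
    exact S.div_mem (MvPolynomial.eval_mem (fun d _ => hnum i d) hargs)
      (MvPolynomial.eval_mem (fun d _ => hden i d) hargs)

/-- Only countably many coefficients occur, and they generate a countable field. The extra element
`c` will be the leading coefficient of a polynomial at which `D` does not vanish. -/
theorem exists_countable_subfield_coeff_mem {n : ℕ} (F : RadicalFormula n)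
    (D : MvPolynomial (Fin (n + 1)) ℂ) (c : ℂ) :
    ∃ K : Subfield ℂ, Countable K ∧ c ∈ K ∧ (∀ d, D.coeff d ∈ K) ∧
      (∀ j d, (F.num j).coeff d ∈ K) ∧ ∀ j d, (F.den j).coeff d ∈ K := by
  let s : Set ℂ := {c} ∪ (Set.range D.coeff ∪ ((⋃ j, Set.range (F.num j).coeff) ∪
    ⋃ j, Set.range (F.den j).coeff))
  have hs : s.Countable := (Set.countable_singleton c).union <| (Set.countable_range _).union <|
    (Set.countable_iUnion fun _ => Set.countable_range _).union <|
      Set.countable_iUnion fun _ => Set.countable_range _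
  have hsub : s ⊆ Subfield.closure s := Subfield.subset_closure
  refine ⟨Subfield.closure s, ?_, hsub (by simp [s]), fun d => hsub ?_, fun j d => hsub ?_,
    fun j d => hsub ?_⟩
  · rw [← Cardinal.mk_le_aleph0_iff]
    exact (Subfield.cardinalMk_closure_le_max s).trans
      (max_le (Cardinal.mk_le_aleph0_iff.2 hs) le_rfl)
  · exact .inr (.inl ⟨d, rfl⟩)
  · exact .inr (.inr (.inl (Set.mem_iUnion.2 ⟨j, d, rfl⟩)))
  · exact .inr (.inr (.inr (Set.mem_iUnion.2 ⟨j, d, rfl⟩)))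

/-- A nonzero polynomial over `K` in the coefficients does not vanish at a polynomial with
leading coefficient `c` in `K` and algebraically independent roots. -/
theorem eval_coeff_prod_ne_zero {n : ℕ} {K : Subfield ℂ} {D : MvPolynomial (Fin (n + 1)) ℂ}
    (hD : ∀ d, D.coeff d ∈ K) {b : Fin (n + 1) → ℂ} (hb : b (Fin.last n) ≠ 0)
    (hbK : b (Fin.last n) ∈ K) (hDb : MvPolynomial.eval b D ≠ 0) {w : Fin n → ℂ}
    (hw : AlgebraicIndependent K w) :
    MvPolynomial.eval (fun i : Fin (n + 1) => b (Fin.last n) *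
      (∏ l, (Polynomial.X - Polynomial.C (w l))).coeff i) D ≠ 0 := by
  obtain ⟨r, hr⟩ := exists_coeffs_eq_prod b hb
  obtain ⟨D', rfl⟩ : D ∈ (MvPolynomial.map (algebraMap K ℂ)).range := by
    rw [RingHom.mem_range, ← Set.mem_range, MvPolynomial.mem_range_map_iff_coeffs_subset]
    intro x hx
    obtain ⟨d, -, rfl⟩ := MvPolynomial.mem_coeffs_iff.1 hx
    exact ⟨⟨_, hD d⟩, rfl⟩
  let Q : Polynomial (MvPolynomial (Fin n) K) :=
    ∏ l, (Polynomial.X - Polynomial.C (MvPolynomial.X l))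
  -- `H` is `D` written in terms of the roots. If it vanished at the independent `w`, it would be
  -- zero, hence would vanish at the roots `r` of `b`, where its value is `D(b) ≠ 0`.
  let H : MvPolynomial (Fin n) K :=
    MvPolynomial.aeval (fun i : Fin (n + 1) => MvPolynomial.C ⟨_, hbK⟩ * Q.coeff i) D'
  have hH (v : Fin n → ℂ) : MvPolynomial.aeval v H =
      MvPolynomial.eval (fun i : Fin (n + 1) => b (Fin.last n) *
        (∏ l, (Polynomial.X - Polynomial.C (v l))).coeff i)
        (MvPolynomial.map (algebraMap K ℂ) D') := by
    have hQ : (∏ l, (Polynomial.X - Polynomial.C (v l))) =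
        Q.map (MvPolynomial.aeval (R := K) v).toRingHom := by
      simp [Q, Polynomial.map_prod]
    rw [MvPolynomial.eval_map, ← MvPolynomial.aeval_def, hQ]
    simp only [H, ← AlgHom.comp_apply, MvPolynomial.comp_aeval, map_mul, Polynomial.coeff_map]
    congr 2
    ext i
    rw [MvPolynomial.aeval_C]
    rfl
  rw [← hH w]
  intro h0
  have hH0 : H = 0 := (injective_iff_map_eq_zero _).1 hw H h0
  apply hDb
  rw [funext hr, ← hH r, hH0, map_zero]

theorem coeff_prod_X_sub_C_last {R : Type*} [CommRing R] {n : ℕ} (w : Fin n → R) :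
    (∏ l, (Polynomial.X - Polynomial.C (w l))).coeff (Fin.last n) = 1 := by
  nontriviality R
  simpa using (Polynomial.monic_prod_X_sub_C w Finset.univ).coeff_natDegree

theorem not_exists_findsRoots {n : ℕ} (hn : 5 ≤ n) : ¬ ∃ P : CalcProgram, P.FindsRoots n := by
  rintro ⟨P, hP⟩
  -- The base field ℚ suffices: the keys introduce no constant other than `1`.
  obtain ⟨w, hw⟩ := exists_algebraicIndependent_of_countable (K := ℚ) n
  obtain ⟨S, hS, -, hcoeff, hwS⟩ := exists_radicalClosed_subfield (by simpa using hn) hw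
  let a : Fin (n + 1) → ℂ := fun i => 1 * (∏ l, (Polynomial.X - Polynomial.C (w l))).coeff i
  have hroot : w ⟨0, by lia⟩ ∈ rootsOfCoeffs a := mem_rootsOfCoeffs_prod 1 w _
  have ha : a (Fin.last n) ≠ 0 := by simp only [a, coeff_prod_X_sub_C_last]; simp
  refine hwS _ ((hP a ha).subset hS (fun x hx => ?_) hroot)
  obtain ⟨i, rfl⟩ := (List.mem_ofFn' _ _).1 hx
  exact S.mul_mem S.one_mem (hcoeff i)

theorem not_exists_solvesAt {n : ℕ} (hn : 5 ≤ n) {D : MvPolynomial (Fin (n + 1)) ℂ} (hD : D ≠ 0) :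
    ¬ ∃ F : RadicalFormula n, ∀ a : Fin (n + 1) → ℂ,
      a (Fin.last n) ≠ 0 → MvPolynomial.eval a D ≠ 0 → F.SolvesAt a := by
  rintro ⟨F, hF⟩
  -- The factor `X (Fin.last n)` makes the same `b` have nonzero leading coefficient.
  obtain ⟨b, hb⟩ : ∃ b, MvPolynomial.eval b (D * MvPolynomial.X (Fin.last n)) ≠ 0 := by
    by_contra! h
    exact mul_ne_zero hD (MvPolynomial.X_ne_zero (Fin.last n))
      (MvPolynomial.funext fun b => by rw [h b, map_zero])
  rw [map_mul, MvPolynomial.eval_X] at hb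
  have hbn := right_ne_zero_of_mul hb
  obtain ⟨K, hK, hbK, hDK, hnum, hden⟩ :=
    exists_countable_subfield_coeff_mem F D (b (Fin.last n))
  obtain ⟨w, hw⟩ := exists_algebraicIndependent_of_countable (K := K) n
  obtain ⟨S, hS, hKS, hcoeff, hwS⟩ := exists_radicalClosed_subfield (by simpa using hn) hw
  have hle {x : ℂ} (hx : x ∈ K) : x ∈ S := hKS ⟨x, hx⟩
  obtain ⟨j, hj⟩ := hF _ (by rw [coeff_prod_X_sub_C_last, mul_one]; exact hbn)
    (eval_coeff_prod_ne_zero hDK hbn hbK (left_ne_zero_of_mul hb) hw) _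
    (mem_rootsOfCoeffs_prod _ w ⟨0, by lia⟩)
  exact hwS _ (hj.mem hS (fun j d => hle (hnum j d)) (fun j d => hle (hden j d))
    fun i => S.mul_mem (hle hbK) (hcoeff i))

theorem mainTheorem1 (n : ℕ) (hn : 5 ≤ n) :
    (¬ ∃ P : CalcProgram, P.FindsRoots n) ∧
    (¬ GeneralEquationSolvableInRadicals n) ∧
    (∀ D : MvPolynomial (Fin (n + 1)) ℂ, D ≠ 0 →
      ¬ ∃ F : RadicalFormula n, ∀ a : Fin (n + 1) → ℂ,
        a (Fin.last n) ≠ 0 → MvPolynomial.eval a D ≠ 0 → F.SolvesAt a) :=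
  ⟨not_exists_findsRoots hn,
    fun ⟨F, hF⟩ => not_exists_solvesAt hn one_ne_zero ⟨F, fun a ha _ => hF a ha⟩,
    fun _ hD => not_exists_solvesAt hn hD⟩
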